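/- Let $\Gamma$ be a torsionless commutative cancellative monoid (written additively), let $R=\bigoplus_{\alpha\in\Gamma}R_\alpha$ be an integral domain graded by $\Gamma$, with quotient field $K$, let $H$ be the set of nonzero homogeneous elements of $R$, and let $R_H\subseteq K$ be its homogeneous quotient field, the localization of $R$ at $H$, graded by the quotient group $\langle\Gamma\rangle$ of $\Gamma$ (so the nonzero homogeneous elements of $R_H$ are the $a/s$ with $a,s\in H$). A fractional ideal $A$ of $R$ is called homogeneous if $sA$ is a homogeneous ideal of $R$ for some $s\in H$. Let $\mathbf{HF}(R)$ be the set of nonzero homogeneous fractional ideals of $R$. A homogeneous star operation on $R$ is a map $\star:\mathbf{HF}(R)\to\mathbf{HF}(R)$, $A\mapsto A^\star$, such that for all nonzero homogeneous $x\in R_H$ and all $A,B\in\mathbf{HF}(R)$: 1. $(x)^\star=(x)$ and $(xA)^\star=xA^\star$; 2. $A\subseteq A^\star$, and $A\subseteq B$ implies $A^\star\subseteq B^\star$; 3. $(A^\star)^\star=A^\star$. Let $\operatorname{HStar}(R)$ be the set of homogeneous star operations on $R$. Such an operation $\star$ is of finite type if, for each $A\in\mathbf{HF}(R)$, $A^\star$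 is the union of the $B^\star$ over all finitely generated $B\in\mathbf{HF}(R)$ with $B\subseteq A$. The Zariski topology on $\operatorname{HStar}(R)$ is the topology having the sets $W_A=\{\star\in\operatorname{HStar}(R) : 1\in A^\star\}$, $A\in\mathbf{HF}(R)$, as a subbasis of open sets; the subset $\operatorname{HStar}_f(R)$ of homogeneous star operations of finite type carries the subspace topology. **Theorem.** The space $\operatorname{HStar}_f(R)$ is a spectral space: it is quasi-compact and $T_0$, its quasi-compact open subsets are closed under finite intersections and form a basis of open sets, and every nonempty irreducible closed subset is the closure of a unique point. -/

import Mathlib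

open scoped nonZeroDivisors

/-!
Homogeneous star operations on a graded integral domain `R = ⨁ R_α`, with quotient field `K`.
-/

set_option linter.unusedSectionVars false

noncomputable section

namespace HomogeneousStar

section Basic

variable {Γ : Type*} [DecidableEq Γ] [AddCancelCommMonoid Γ]
  {R : Type*} [CommRing R] [IsDomain R] (𝒜 : Γ → AddSubgroup R) [GradedRing 𝒜]
  {K : Type*} [Field K] [Algebra R K] [IsFractionRing R K]

/-- The nonzero homogeneous elements of the homogeneous quotient field `R_H ⊆ K`, where `H` is the
set of nonzero homogeneous elements of `R`. The component of `R_H` in a degree `δ` of the quotient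
group of `Γ` consists of the quotients `a / s` with `s ∈ H` and `a ∈ R` homogeneous such that
`a = 0` or `deg a - deg s = δ`; so its nonzero homogeneous elements are the `a / s` with
`a, s ∈ H`. -/
def IsHomogeneousUnit (x : K) : Prop :=
  ∃ a s : R, SetLike.IsHomogeneousElem 𝒜 a ∧ a ≠ 0 ∧ SetLike.IsHomogeneousElem 𝒜 s ∧ s ≠ 0 ∧
    x = algebraMap R K a / algebraMap R K s

/-- A fractional ideal `A` of `R` is homogeneous if `s A` is an (integral) homogeneous ideal of `R`
for some nonzero homogeneous element `s` of `R`. -/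
def IsHomogeneousFractional (A : FractionalIdeal R⁰ K) : Prop :=
  ∃ s : R, SetLike.IsHomogeneousElem 𝒜 s ∧ s ≠ 0 ∧ ∃ J : Ideal R, J.IsHomogeneous 𝒜 ∧
    FractionalIdeal.spanSingleton R⁰ (algebraMap R K s) * A = (J : FractionalIdeal R⁰ K)

variable (K) in
/-- `HF(R)`: the nonzero homogeneous fractional ideals of `R`, ordered by inclusion. -/
abbrev HF : Type _ :=
  {A : FractionalIdeal R⁰ K // A ≠ 0 ∧ IsHomogeneousFractional 𝒜 A}

variable {𝒜}

theorem isHomogeneousFractional_spanSingleton {x : K} (hx : IsHomogeneousUnit 𝒜 x) :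
    IsHomogeneousFractional 𝒜 (FractionalIdeal.spanSingleton R⁰ x) := by
  obtain ⟨a, s, ha, -, hs, hs0, rfl⟩ := hx
  have hs' : algebraMap R K s ≠ 0 := by simpa using hs0
  refine ⟨s, hs, hs0, Ideal.span {a}, Ideal.homogeneous_span _ _ (by simpa using ha), ?_⟩
  rw [FractionalIdeal.spanSingleton_mul_spanSingleton, FractionalIdeal.coeIdeal_span_singleton,
    mul_div_cancel₀ _ hs']

theorem isHomogeneousFractional_smul {x : K} (hx : IsHomogeneousUnit 𝒜 x)
    {A : FractionalIdeal R⁰ K} (hA : IsHomogeneousFractional 𝒜 A) :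
    IsHomogeneousFractional 𝒜 (FractionalIdeal.spanSingleton R⁰ x * A) := by
  obtain ⟨s, ⟨i, hs⟩, hs0, J, hJ, hJA⟩ := hx |> isHomogeneousFractional_spanSingleton
  obtain ⟨t, ⟨j, ht⟩, ht0, J', hJ', hJA'⟩ := hA
  refine ⟨s * t, ⟨i + j, SetLike.mul_mem_graded hs ht⟩, mul_ne_zero hs0 ht0, J * J', hJ.mul hJ', ?_⟩
  rw [FractionalIdeal.coeIdeal_mul, ← hJA, ← hJA', map_mul,
    ← FractionalIdeal.spanSingleton_mul_spanSingleton]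
  ring

theorem IsHomogeneousUnit.ne_zero {x : K} (hx : IsHomogeneousUnit 𝒜 x) : x ≠ 0 := by
  obtain ⟨a, s, -, ha, -, hs, rfl⟩ := hx
  simpa [div_eq_zero_iff] using And.intro ha hs

/-- The principal fractional ideal `(x)`, for `x ∈ R_H` homogeneous and nonzero. -/
def HF.principal (x : K) (hx : IsHomogeneousUnit 𝒜 x) : HF 𝒜 K :=
  ⟨FractionalIdeal.spanSingleton R⁰ x,
    FractionalIdeal.spanSingleton_ne_zero_iff.mpr hx.ne_zero,
    isHomogeneousFractional_spanSingleton hx⟩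

/-- The fractional ideal `x A`, for `x ∈ R_H` homogeneous and nonzero. -/
def HF.smul (x : K) (hx : IsHomogeneousUnit 𝒜 x) (A : HF 𝒜 K) : HF 𝒜 K :=
  ⟨FractionalIdeal.spanSingleton R⁰ x * A.1,
    fun h => A.2.1 <| by
      have h' := congrArg (FractionalIdeal.spanSingleton R⁰ x⁻¹ * ·) h
      simpa [← mul_assoc, FractionalIdeal.spanSingleton_mul_spanSingleton, hx.ne_zero] using h',
    isHomogeneousFractional_smul hx A.2.2⟩

/-- `A` is finitely generated as an `R`-module. -/
def HF.IsFinGen (A : HF 𝒜 K) : Prop := (A.1 : Submodule R K).FG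

variable (𝒜 K)

/-- `HStar(R)`: the homogeneous star operations on `R`. -/
structure HStar where
  /-- The underlying map `A ↦ A^⋆`. -/
  star : HF 𝒜 K → HF 𝒜 K
  star_principal : ∀ (x : K) (hx : IsHomogeneousUnit 𝒜 x),
    star (HF.principal x hx) = HF.principal x hx
  star_smul : ∀ (x : K) (hx : IsHomogeneousUnit 𝒜 x) (A : HF 𝒜 K),
    star (HF.smul x hx A) = HF.smul x hx (star A)
  le_star : ∀ A : HF 𝒜 K, A ≤ star A
  star_mono : ∀ A B : HF 𝒜 K, A ≤ B → star A ≤ star B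
  star_star : ∀ A : HF 𝒜 K, star (star A) = star A

variable {𝒜 K}

/-- `⋆` is of finite type if `⋆ = ⋆_f`: for each `A ∈ HF(R)`, the set `A^⋆` is the union of the
`B^⋆` over the finitely generated `B ∈ HF(R)` with `B ⊆ A`. -/
def HStar.IsFiniteType (σ : HStar 𝒜 K) : Prop :=
  ∀ A : HF 𝒜 K,
    ((σ.star A).1 : Set K) = ⋃ B ∈ {B : HF 𝒜 K | B.IsFinGen ∧ B ≤ A}, ((σ.star B).1 : Set K)

/-- The set `W_A = {⋆ ∈ HStar(R) : 1 ∈ A^⋆}`. -/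
def HStar.W (A : HF 𝒜 K) : Set (HStar 𝒜 K) := {σ | (1 : K) ∈ (σ.star A).1}

variable (𝒜 K)

/-- The Zariski topology on `HStar(R)`, with subbasis the sets `W_A`. -/
instance HStar.zariskiTopology : TopologicalSpace (HStar 𝒜 K) :=
  TopologicalSpace.generateFrom (Set.range HStar.W)

/-- `HStar_f(R)`: the homogeneous star operations of finite type, with the subspace topology. -/
abbrev HStarFin : Type _ := {σ : HStar 𝒜 K // σ.IsFiniteType}

end Basic

end HomogeneousStar

end

/-! A T₀ space is spectral once every ultrafilter `U` has a point lying in exactly those members of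
a subbasis that belong to `U`. Such points make all intersections of subbasic sets quasi-compact,
and applied to an ultrafilter refining the traces of opens on an irreducible closed set they give
its generic point. Star operations of finite type are determined by their values on finitely
generated `B`, so the sets `W_B` with `B` finitely generated already form a subbasis of
`HStar_f(R)`. The required limit (`HStar.liminf`) puts `x` in the value at such a `B` when `x ∈ B^⋆`
for `U`-almost all `⋆`, and extends to all `A` by directed union. The delicate axiom is idempotence:
finitely many generators of `B` can be controlled simultaneously on one set of `U`. T₀ holds because
homogeneous ideals are generated by homogeneous elements, whose membership is read off from the sets
`W_A` by scaling. -/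

open Filter Topology TopologicalSpace in
/-- A `T₀` space with a subbasis `S` such that every ultrafilter `U` has an ultrafilter limit point
with respect to `S` (a point lying in exactly those members of `S` that belong to `U`) is
spectral. -/
theorem SpectralSpace.of_forall_ultrafilter {X : Type*} [t : TopologicalSpace X] [T0Space X]
    {S : Set (Set X)} (hS : t = generateFrom S)
    (h : ∀ U : Ultrafilter X, ∃ x, ∀ s ∈ S, x ∈ s ↔ s ∈ U) : SpectralSpace X := by
  have hopen : ∀ s ∈ S, IsOpen s := fun s hs => hS ▸ isOpen_generateFrom_of_mem hs
  have hbasis := isTopologicalBasis_of_subbasis hS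
  have hcompact : ∀ F : Set (Set X), F ⊆ S → IsCompact (⋂₀ F) := by
    intro F hF
    rw [isCompact_iff_ultrafilter_le_nhds']
    intro U hU
    obtain ⟨x, hx⟩ := h U
    refine ⟨x, fun s hs => (hx s (hF hs)).2 (mem_of_superset hU (Set.sInter_subset_of_mem hs)), ?_⟩
    subst hS
    rw [nhds_generateFrom]
    simp only [le_iInf_iff, le_principal_iff]
    exact fun s hs => (hx s hs.2).1 hs.1
  have hcompact' : ∀ V ∈ (fun f => ⋂₀ f) '' {f : Set (Set X) | f.Finite ∧ f ⊆ S},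
      IsCompact V := by
    rintro _ ⟨F, hF, rfl⟩
    exact hcompact F hF.2
  have : PrespectralSpace X := .of_isTopologicalBasis hbasis hcompact'
  have : CompactSpace X := ⟨by simpa using hcompact ∅ (Set.empty_subset _)⟩
  have : QuasiSeparatedSpace X := by
    refine QuasiSeparatedSpace.of_isTopologicalBasis (b := Subtype.val) (ι :=
      (fun f => ⋂₀ f) '' {f : Set (Set X) | f.Finite ∧ f ⊆ S}) (by rwa [Subtype.range_coe]) ?_
    rintro ⟨_, F, hF, rfl⟩ ⟨_, G, hG, rfl⟩
    simp only [← Set.sInter_union]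
    exact hcompact _ (Set.union_subset hF.2 hG.2)
  have : QuasiSober X := by
    refine ⟨fun {Z} hZ hZc => ?_⟩
    -- The filter generated by the nonempty traces of open sets on `Z`; irreducibility makes it
    -- closed under intersection.
    let F : Filter X :=
      { sets := {s | ∃ V, IsOpen V ∧ (Z ∩ V).Nonempty ∧ Z ∩ V ⊆ s}
        univ_sets := ⟨Set.univ, isOpen_univ, by simpa using hZ.1, Set.subset_univ _⟩
        sets_of_superset := fun ⟨V, hV, hZV, hs⟩ hst => ⟨V, hV, hZV, hs.trans hst⟩
        inter_sets := fun ⟨V, hV, hZV, hs⟩ ⟨W, hW, hZW, ht⟩ =>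
          ⟨V ∩ W, hV.inter hW, hZ.2 V W hV hW hZV hZW, fun _ hx =>
            ⟨hs ⟨hx.1, hx.2.1⟩, ht ⟨hx.1, hx.2.2⟩⟩⟩ }
    have : F.NeBot := ⟨fun hF => by
      obtain ⟨V, -, hV, hV'⟩ : (∅ : Set X) ∈ F := hF ▸ mem_bot
      exact (hV.mono hV').ne_empty rfl⟩
    have hle : ∀ s ∈ F, s ∈ Ultrafilter.of F := fun s hs => Ultrafilter.of_le F hs
    have hZmem : Z ∈ Ultrafilter.of F :=
      hle Z ⟨Set.univ, isOpen_univ, by simpa using hZ.1, Set.inter_subset_left⟩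
    obtain ⟨x, hx⟩ := h (Ultrafilter.of F)
    refine ⟨x, subset_antisymm (hZc.closure_subset_iff.2 (Set.singleton_subset_iff.2 ?_)) ?_⟩
    -- Otherwise a basic neighbourhood of `x` missing `Z` belongs to the ultrafilter, which also
    -- contains `Z`.
    · by_contra hxZ
      obtain ⟨_, ⟨G, hG, rfl⟩, hxG, hGZ⟩ := hbasis.exists_subset_of_mem_open hxZ hZc.isOpen_compl
      have hGmem : ⋂₀ G ∈ Ultrafilter.of F :=
        (sInter_mem hG.1).2 fun s hs => (hx s (hG.2 hs)).1 (hxG s hs)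
      obtain ⟨y, hy, hyZ⟩ := (Ultrafilter.of F).nonempty_of_mem (inter_mem hGmem hZmem)
      exact hGZ hy hyZ
    · intro z hz
      rw [hbasis.mem_closure_iff]
      rintro _ ⟨G, hG, rfl⟩ hzG
      exact ⟨x, fun s hs => (hx s (hG.2 hs)).2 <| hle s
        ⟨s, hopen s (hG.2 hs), ⟨z, hz, hzG s hs⟩, Set.inter_subset_right⟩, rfl⟩
  constructor

namespace HomogeneousStar

open Filter

variable {Γ : Type*} [DecidableEq Γ] [AddCancelCommMonoid Γ]
  {R : Type*} [CommRing R] [IsDomain R] {𝒜 : Γ → AddSubgroup R} [GradedRing 𝒜]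
  {K : Type*} [Field K] [Algebra R K] [IsFractionRing R K]

/-! ### Homogeneous fractional ideals -/

theorem IsHomogeneousUnit.inv {x : K} (hx : IsHomogeneousUnit 𝒜 x) :
    IsHomogeneousUnit 𝒜 x⁻¹ := by
  obtain ⟨a, s, ha, ha0, hs, hs0, rfl⟩ := hx
  exact ⟨s, a, hs, hs0, ha, ha0, by rw [inv_div]⟩

theorem isHomogeneousUnit_div {s : R} (hs : SetLike.IsHomogeneousElem 𝒜 s) (hs0 : s ≠ 0) {a : R}
    (i : Γ) (ha : (DirectSum.decompose 𝒜 a i : R) ≠ 0) :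
    IsHomogeneousUnit 𝒜 (algebraMap R K (DirectSum.decompose 𝒜 a i) / algebraMap R K s) :=
  ⟨_, s, ⟨i, SetLike.coe_mem _⟩, ha, hs, hs0, rfl⟩

theorem isHomogeneousUnit_one_div {s : R} (hs : SetLike.IsHomogeneousElem 𝒜 s) (hs0 : s ≠ 0) :
    IsHomogeneousUnit 𝒜 (1 / algebraMap R K s) :=
  ⟨1, s, SetLike.isHomogeneousElem_one 𝒜, one_ne_zero, hs, hs0, by simp⟩

theorem div_mem_of_forall_component_mem {M : Submodule R K} {s a : R}
    (h : ∀ i, (DirectSum.decompose 𝒜 a i : R) ≠ 0 →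
      algebraMap R K (DirectSum.decompose 𝒜 a i) / algebraMap R K s ∈ M) :
    algebraMap R K a / algebraMap R K s ∈ M := by
  classical
  rw [← DirectSum.sum_support_decompose 𝒜 a, map_sum, Finset.sum_div]
  exact Submodule.sum_mem _ fun i hi => h i (by simpa using hi)

/-- Every homogeneous fractional ideal is contained in some `(1 / s)` with `s` homogeneous. -/
theorem HF.exists_le_principal (A : HF 𝒜 K) :
    ∃ (s : R) (hs : SetLike.IsHomogeneousElem 𝒜 s) (hs0 : s ≠ 0),
      A ≤ HF.principal (1 / algebraMap R K s) (isHomogeneousUnit_one_div hs hs0) := by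
  obtain ⟨s, hs, hs0, J, -, hJ⟩ := A.2.2
  have hs' : algebraMap R K s ≠ 0 := by simpa using hs0
  refine ⟨s, hs, hs0, fun x hx => ?_⟩
  have hx' : algebraMap R K s * x ∈ (J : FractionalIdeal R⁰ K) :=
    hJ ▸ (FractionalIdeal.mem_singleton_mul.2 ⟨x, hx, rfl⟩)
  obtain ⟨a, -, ha⟩ := (FractionalIdeal.mem_coeIdeal _).1 hx'
  refine (FractionalIdeal.mem_spanSingleton _).2 ⟨a, ?_⟩
  rw [Algebra.smul_def, ha]
  field_simp

theorem HF.exists_eq_div_of_mem_principal {s : R} {hs : IsHomogeneousUnit 𝒜 (1 / algebraMap R K s)}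
    {x : K} (hx : x ∈ (HF.principal _ hs).1) : ∃ a : R, x = algebraMap R K a / algebraMap R K s := by
  obtain ⟨a, rfl⟩ := (FractionalIdeal.mem_spanSingleton _).1 hx
  exact ⟨a, by rw [Algebra.smul_def, mul_one_div]⟩

/-- Homogeneous fractional ideals contain the homogeneous components of their elements. -/
theorem HF.component_mem (A : HF 𝒜 K) {s a : R} (hs : SetLike.IsHomogeneousElem 𝒜 s) (hs0 : s ≠ 0)
    (h : algebraMap R K a / algebraMap R K s ∈ A.1) (i : Γ) :
    algebraMap R K (DirectSum.decompose 𝒜 a i) / algebraMap R K s ∈ A.1 := by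
  obtain ⟨t, ⟨d, ht⟩, ht0, J, hJ, hJA⟩ := A.2.2
  have hs' : algebraMap R K s ≠ 0 := by simpa using hs0
  have ht' : algebraMap R K t ≠ 0 := by simpa using ht0
  -- Clearing both denominators moves the question into the integral homogeneous ideal `s J`.
  have hmem : ∀ b : R, t * b ∈ Ideal.span {s} * J ↔
      algebraMap R K b / algebraMap R K s ∈ A.1 := by
    intro b
    have hiff : algebraMap R K b / algebraMap R K s ∈ A.1 ↔
        algebraMap R K t * (algebraMap R K b / algebraMap R K s) ∈ (J : FractionalIdeal R⁰ K) := by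
      rw [← hJA, FractionalIdeal.mem_singleton_mul]
      refine ⟨fun h => ⟨_, h, rfl⟩, ?_⟩
      rintro ⟨y, hy, hyb⟩
      rwa [mul_left_cancel₀ ht' hyb]
    rw [hiff, FractionalIdeal.mem_coeIdeal, Ideal.mem_span_singleton_mul]
    refine exists_congr fun j => and_congr_right fun _ => ?_
    rw [← (IsFractionRing.injective R K).eq_iff, map_mul, map_mul, mul_div_assoc', eq_div_iff hs',
      mul_comm]
  rw [← hmem] at h ⊢
  have hhom : (Ideal.span {s} * J).IsHomogeneous 𝒜 :=
    (Ideal.homogeneous_span _ _ (by simpa using hs)).mul hJ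
  -- As `t` is homogeneous of degree `d`, the component of `t * a` in degree `d + i` is `t` times
  -- that of `a` in degree `i`.
  have := hhom (d + i) h
  rwa [DirectSum.coe_decompose_mul_add_of_left_mem 𝒜 ht] at this

/-- A homogeneous fractional ideal is generated by its homogeneous elements. -/
theorem HF.le_of_forall_isHomogeneousUnit (A : HF 𝒜 K) (M : Submodule R K)
    (h : ∀ x : K, IsHomogeneousUnit 𝒜 x → x ∈ A.1 → x ∈ M) : (A.1 : Submodule R K) ≤ M := by
  intro x hx
  obtain ⟨s, hs, hs0, hle⟩ := A.exists_le_principal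
  obtain ⟨a, rfl⟩ := HF.exists_eq_div_of_mem_principal (hle hx)
  exact div_mem_of_forall_component_mem fun i hi =>
    h _ (isHomogeneousUnit_div hs hs0 i hi) (A.component_mem hs hs0 hx i)

/-- A nonzero submodule of `(1 / s)` which contains the homogeneous components of its elements is a
homogeneous fractional ideal. -/
theorem HF.exists_coe_eq (M : Submodule R K) (hM : M ≠ ⊥) {s : R}
    (hs : SetLike.IsHomogeneousElem 𝒜 s) (hs0 : s ≠ 0)
    (hle : ∀ x ∈ M, ∃ a : R, x = algebraMap R K a / algebraMap R K s)
    (hcomp : ∀ a : R, algebraMap R K a / algebraMap R K s ∈ M → ∀ i : Γ,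
      algebraMap R K (DirectSum.decompose 𝒜 a i) / algebraMap R K s ∈ M) :
    ∃ A : HF 𝒜 K, (A.1 : Submodule R K) = M := by
  have hs' : algebraMap R K s ≠ 0 := by simpa using hs0
  let A : FractionalIdeal R⁰ K := ⟨M, s, mem_nonZeroDivisors_of_ne_zero hs0, fun x hx => by
    obtain ⟨a, rfl⟩ := hle x hx
    exact ⟨a, by rw [Algebra.smul_def, mul_div_cancel₀ _ hs']⟩⟩
  let J : Ideal R := M.comap (LinearMap.toSpanSingleton R K (1 / algebraMap R K s))
  have hJ : ∀ a, a ∈ J ↔ algebraMap R K a / algebraMap R K s ∈ M := fun a => by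
    simp [J, Algebra.smul_def, div_eq_mul_inv]
  refine ⟨⟨A, fun h => hM ?_, s, hs, hs0, J, fun i a ha => ?_, ?_⟩, rfl⟩
  · have := congrArg (fun B : FractionalIdeal R⁰ K => (B : Submodule R K)) h
    simpa only [FractionalIdeal.coe_zero] using! this
  · rw [hJ] at ha ⊢
    exact hcomp a ha i
  · ext x
    rw [FractionalIdeal.mem_singleton_mul, FractionalIdeal.mem_coeIdeal]
    constructor
    · rintro ⟨y, hy, rfl⟩
      obtain ⟨a, rfl⟩ := hle y hy
      exact ⟨a, (hJ a).2 hy, by rw [mul_div_cancel₀ _ hs']⟩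
    · rintro ⟨a, ha, rfl⟩
      exact ⟨_, (hJ a).1 ha, by rw [mul_div_cancel₀ _ hs']⟩

/-- The sum of two finitely generated homogeneous fractional ideals. -/
theorem HF.exists_isFinGen_sup {B C : HF 𝒜 K} (hB : B.IsFinGen) (hC : C.IsFinGen) :
    ∃ D : HF 𝒜 K, D.IsFinGen ∧ (∀ A, B ≤ A → C ≤ A → D ≤ A) ∧ B ≤ D ∧ C ≤ D := by
  obtain ⟨s, hs, hs0, J, hJ, hsB⟩ := B.2.2
  obtain ⟨t, ht, ht0, I, hI, htC⟩ := C.2.2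
  refine ⟨⟨B.1 ⊔ C.1, fun h => B.2.1 (le_bot_iff.1 (le_sup_left.trans h.le)), s * t, ?_,
    mul_ne_zero hs0 ht0, Ideal.span {t} * J ⊔ Ideal.span {s} * I, ?_, ?_⟩, ?_, ?_, ?_, ?_⟩
  · exact hs.mul ht
  · exact ((Ideal.homogeneous_span _ _ (by simpa using ht)).mul hJ).sup
      ((Ideal.homogeneous_span _ _ (by simpa using hs)).mul hI)
  · rw [FractionalIdeal.sup_eq_add, FractionalIdeal.coeIdeal_sup, FractionalIdeal.coeIdeal_mul,
      FractionalIdeal.coeIdeal_mul, ← hsB, ← htC, FractionalIdeal.coeIdeal_span_singleton,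
      FractionalIdeal.coeIdeal_span_singleton, map_mul,
      ← FractionalIdeal.spanSingleton_mul_spanSingleton]
    ring
  · exact Submodule.FG.sup hB hC
  · exact fun A hBA hCA => sup_le (α := FractionalIdeal R⁰ K) hBA hCA
  · exact le_sup_left (α := FractionalIdeal R⁰ K)
  · exact le_sup_right (α := FractionalIdeal R⁰ K)

theorem HF.isFinGen_principal {x : K} (hx : IsHomogeneousUnit 𝒜 x) :
    (HF.principal x hx).IsFinGen := by
  simpa [HF.IsFinGen, HF.principal] using Submodule.fg_span_singleton (R := R) x

theorem HF.mem_principal_self {x : K} (hx : IsHomogeneousUnit 𝒜 x) :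
    x ∈ (HF.principal x hx).1 :=
  FractionalIdeal.mem_spanSingleton_self _ x

theorem HF.principal_le {x : K} (hx : IsHomogeneousUnit 𝒜 x) {A : HF 𝒜 K} (h : x ∈ A.1) :
    HF.principal x hx ≤ A :=
  FractionalIdeal.spanSingleton_le_iff_mem.2 h

theorem HF.mem_smul {x y : K} (hx : IsHomogeneousUnit 𝒜 x) {A : HF 𝒜 K} :
    y ∈ (HF.smul x hx A).1 ↔ ∃ z ∈ A.1, y = x * z :=
  FractionalIdeal.mem_singleton_mul

theorem HF.IsFinGen.smul {x : K} (hx : IsHomogeneousUnit 𝒜 x) {A : HF 𝒜 K} (hA : A.IsFinGen) :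
    (HF.smul x hx A).IsFinGen := by
  unfold HF.IsFinGen HF.smul
  rw [FractionalIdeal.coe_mul, FractionalIdeal.coe_spanSingleton]
  exact (Submodule.fg_span_singleton x).mul hA

theorem HF.smul_mono {x : K} (hx : IsHomogeneousUnit 𝒜 x) {A B : HF 𝒜 K} (h : A ≤ B) :
    HF.smul x hx A ≤ HF.smul x hx B := by
  intro y hy
  obtain ⟨z, hz, rfl⟩ := (HF.mem_smul hx).1 hy
  exact (HF.mem_smul hx).2 ⟨z, h hz, rfl⟩

theorem HF.smul_inv_smul {x : K} (hx : IsHomogeneousUnit 𝒜 x) (A : HF 𝒜 K) :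
    HF.smul x hx (HF.smul x⁻¹ hx.inv A) = A := by
  apply Subtype.ext
  simp [HF.smul, ← mul_assoc, FractionalIdeal.spanSingleton_mul_spanSingleton, hx.ne_zero]

theorem HF.inv_smul_smul {x : K} (hx : IsHomogeneousUnit 𝒜 x) (A : HF 𝒜 K) :
    HF.smul x⁻¹ hx.inv (HF.smul x hx A) = A := by
  apply Subtype.ext
  simp [HF.smul, ← mul_assoc, FractionalIdeal.spanSingleton_mul_spanSingleton, hx.ne_zero]

/-! ### Separation and the subbasis of finitely generated ideals -/

theorem HStar.ext' {σ τ : HStar 𝒜 K} (h : ∀ A, σ.star A = τ.star A) : σ = τ := by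
  have : σ.star = τ.star := funext h
  cases σ; cases τ; cases this; rfl

/-- Scaling by `x⁻¹` turns membership of any homogeneous `x` into membership of `1`, the only kind
the topology sees. -/
theorem HStar.mem_star_iff (σ : HStar 𝒜 K) {x : K} (hx : IsHomogeneousUnit 𝒜 x) (A : HF 𝒜 K) :
    x ∈ (σ.star A).1 ↔ (1 : K) ∈ (σ.star (HF.smul x⁻¹ hx.inv A)).1 := by
  rw [σ.star_smul, HF.mem_smul]
  constructor
  · exact fun h => ⟨x, h, (inv_mul_cancel₀ hx.ne_zero).symm⟩
  · rintro ⟨z, hz, h⟩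
    rw [eq_inv_mul_iff_mul_eq₀ hx.ne_zero, mul_one] at h
    rwa [h]

/-- The sets `W_A` separate homogeneous star operations. -/
theorem HStar.ext_one_mem {σ τ : HStar 𝒜 K}
    (h : ∀ A, (1 : K) ∈ (σ.star A).1 ↔ (1 : K) ∈ (τ.star A).1) : σ = τ := by
  refine HStar.ext' fun A => le_antisymm ?_ ?_
  · exact HF.le_of_forall_isHomogeneousUnit (σ.star A) (τ.star A).1 fun x hx hxA =>
      (τ.mem_star_iff hx A).2 ((h _).1 ((σ.mem_star_iff hx A).1 hxA))
  · exact HF.le_of_forall_isHomogeneousUnit (τ.star A) (σ.star A).1 fun x hx hxA =>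
      (σ.mem_star_iff hx A).2 ((h _).2 ((τ.mem_star_iff hx A).1 hxA))

instance : T0Space (HStar 𝒜 K) := by
  refine ⟨fun σ τ h => HStar.ext_one_mem fun A => ?_⟩
  exact h.mem_open_iff (TopologicalSpace.isOpen_generateFrom_of_mem ⟨A, rfl⟩)

theorem HStar.IsFiniteType.mem_star_iff {σ : HStar 𝒜 K} (hσ : σ.IsFiniteType) {A : HF 𝒜 K}
    {x : K} : x ∈ (σ.star A).1 ↔ ∃ B : HF 𝒜 K, B.IsFinGen ∧ B ≤ A ∧ x ∈ (σ.star B).1 := by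
  have := Set.ext_iff.1 (hσ A) x
  simpa [and_assoc] using this

variable (𝒜 K) in
/-- The traces on `HStar_f(R)` of the sets `W_B`, for `B` finitely generated. -/
def HStarFin.subbasis : Set (Set (HStarFin 𝒜 K)) :=
  {s | ∃ B : HF 𝒜 K, B.IsFinGen ∧ s = {σ | (1 : K) ∈ (σ.1.star B).1}}

theorem HStarFin.topology_eq_generateFrom :
    (instTopologicalSpaceSubtype : TopologicalSpace (HStarFin 𝒜 K)) =
      TopologicalSpace.generateFrom (HStarFin.subbasis 𝒜 K) := by
  refine le_antisymm (le_generateFrom ?_) ?_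
  · rintro _ ⟨B, -, rfl⟩
    exact continuous_subtype_val.isOpen_preimage (HStar.W B)
      (TopologicalSpace.isOpen_generateFrom_of_mem ⟨B, rfl⟩)
  · change _ ≤ TopologicalSpace.induced Subtype.val
      (TopologicalSpace.generateFrom (Set.range HStar.W))
    rw [induced_generateFrom_eq]
    refine le_generateFrom ?_
    rintro _ ⟨_, ⟨A, rfl⟩, rfl⟩
    -- Finite type is used here: `1 ∈ A^⋆` is witnessed by a finitely generated `B ≤ A`.
    have : (Subtype.val ⁻¹' HStar.W A : Set (HStarFin 𝒜 K)) =
        ⋃ B ∈ {B : HF 𝒜 K | B.IsFinGen ∧ B ≤ A}, {σ | (1 : K) ∈ (σ.1.star B).1} := by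
      ext σ
      simpa [HStar.W, and_assoc] using σ.2.mem_star_iff (A := A) (x := 1)
    rw [this]
    let := TopologicalSpace.generateFrom (HStarFin.subbasis 𝒜 K)
    exact isOpen_biUnion fun B hB => TopologicalSpace.isOpen_generateFrom_of_mem ⟨B, hB.1, rfl⟩

/-! ### Limits of star operations along a filter -/

theorem HF.coe_ne_bot (A : HF 𝒜 K) : (A.1 : Submodule R K) ≠ ⊥ := fun h =>
  A.2.1 (FractionalIdeal.coeToSubmodule_injective (h.trans FractionalIdeal.coe_zero.symm))

theorem HF.exists_isFinGen_le (A : HF 𝒜 K) : ∃ B : HF 𝒜 K, B.IsFinGen ∧ B ≤ A := by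
  by_contra! h
  refine A.coe_ne_bot (le_bot_iff.1 ?_)
  exact A.le_of_forall_isHomogeneousUnit ⊥ fun x hx hxA =>
    (h _ (HF.isFinGen_principal hx) (HF.principal_le hx hxA)).elim

/-- The submodule underlying the value at `A` of the limit inferior of the homogeneous star
operations along a filter `U`. -/
noncomputable def HStar.liminfSubmodule (U : Filter (HStar 𝒜 K)) (A : HF 𝒜 K) : Submodule R K where
  carrier := {x | ∃ B : HF 𝒜 K, B.IsFinGen ∧ B ≤ A ∧ ∀ᶠ σ in U, x ∈ (σ.star B).1}
  zero_mem' := by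
    obtain ⟨B, hB, hBA⟩ := A.exists_isFinGen_le
    exact ⟨B, hB, hBA, .of_forall fun σ => Submodule.zero_mem (σ.star B).1.1⟩
  add_mem' := by
    rintro x y ⟨B, hB, hBA, hx⟩ ⟨C, hC, hCA, hy⟩
    obtain ⟨D, hD, hDle, hBD, hCD⟩ := HF.exists_isFinGen_sup hB hC
    refine ⟨D, hD, hDle A hBA hCA, ?_⟩
    filter_upwards [hx, hy] with σ hx hy
    exact Submodule.add_mem (σ.star D).1.1 (σ.star_mono _ _ hBD hx) (σ.star_mono _ _ hCD hy)
  smul_mem' := by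
    rintro r x ⟨B, hB, hBA, hx⟩
    exact ⟨B, hB, hBA, hx.mono fun σ hx => Submodule.smul_mem (σ.star B).1.1 r hx⟩

theorem HStar.mem_liminfSubmodule {U : Filter (HStar 𝒜 K)} {A : HF 𝒜 K} {x : K} :
    x ∈ liminfSubmodule U A ↔
      ∃ B : HF 𝒜 K, B.IsFinGen ∧ B ≤ A ∧ ∀ᶠ σ in U, x ∈ (σ.star B).1 :=
  Iff.rfl

theorem HStar.le_liminfSubmodule (U : Filter (HStar 𝒜 K)) (A : HF 𝒜 K) :
    (A.1 : Submodule R K) ≤ liminfSubmodule U A :=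
  A.le_of_forall_isHomogeneousUnit _ fun _ hx hxA =>
    ⟨_, HF.isFinGen_principal hx, HF.principal_le hx hxA,
      .of_forall fun σ => σ.le_star _ (HF.mem_principal_self hx)⟩

theorem HStar.exists_coe_eq_liminfSubmodule (U : Filter (HStar 𝒜 K)) [U.NeBot] (A : HF 𝒜 K) :
    ∃ B : HF 𝒜 K, (B.1 : Submodule R K) = liminfSubmodule U A := by
  obtain ⟨s, hs, hs0, hle⟩ := A.exists_le_principal
  refine HF.exists_coe_eq _ (fun h => ?_) hs hs0 ?_ ?_
  · exact A.coe_ne_bot (le_bot_iff.1 (h ▸ le_liminfSubmodule U A))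
  · rintro x ⟨B, -, hBA, hx⟩
    -- The bound `(1 / s)` on `A` persists in the limit, since every star operation fixes principal
    -- ideals.
    obtain ⟨σ, hσ⟩ := hx.exists
    refine HF.exists_eq_div_of_mem_principal (hs := isHomogeneousUnit_one_div hs hs0) ?_
    rw [← σ.star_principal]
    exact σ.star_mono _ _ (hBA.trans hle) hσ
  · rintro a ⟨B, hB, hBA, ha⟩ i
    exact ⟨B, hB, hBA, ha.mono fun σ ha => HF.component_mem _ hs hs0 ha i⟩

/-- The value at `A` of the limit inferior of the homogeneous star operations
along a filter `U`. -/
noncomputable def HStar.liminfStar (U : Filter (HStar 𝒜 K)) [U.NeBot] (A : HF 𝒜 K) : HF 𝒜 K :=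
  (exists_coe_eq_liminfSubmodule U A).choose

theorem HStar.coe_liminfStar (U : Filter (HStar 𝒜 K)) [U.NeBot] (A : HF 𝒜 K) :
    ((liminfStar U A).1 : Submodule R K) = liminfSubmodule U A :=
  (exists_coe_eq_liminfSubmodule U A).choose_spec

theorem HStar.mem_liminfStar {U : Filter (HStar 𝒜 K)} [U.NeBot] {A : HF 𝒜 K} {x : K} :
    x ∈ (liminfStar U A).1 ↔
      ∃ B : HF 𝒜 K, B.IsFinGen ∧ B ≤ A ∧ ∀ᶠ σ in U, x ∈ (σ.star B).1 := by
  rw [← mem_liminfSubmodule, ← coe_liminfStar, FractionalIdeal.mem_coe]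

/-- Each generator has its own witness; the sum of these finitely many ideals serves all of them.
This is what makes the limit idempotent. -/
theorem HStar.exists_eventually_le_star {U : Filter (HStar 𝒜 K)} {A : HF 𝒜 K}
    {N : Submodule R K} (hN : N.FG) (h : N ≤ liminfSubmodule U A) :
    ∃ B : HF 𝒜 K, B.IsFinGen ∧ B ≤ A ∧ ∀ᶠ σ in U, N ≤ (σ.star B).1 := by
  induction N, hN using Submodule.fg_induction with
  | singleton x =>
    simpa only [Submodule.span_singleton_le_iff_mem, FractionalIdeal.mem_coe,
      mem_liminfSubmodule] using h
  | sup N₁ N₂ _ _ h₁ h₂ =>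
    obtain ⟨B, hB, hBA, hx⟩ := h₁ (le_sup_left.trans h)
    obtain ⟨C, hC, hCA, hy⟩ := h₂ (le_sup_right.trans h)
    obtain ⟨D, hD, hDle, hBD, hCD⟩ := HF.exists_isFinGen_sup hB hC
    refine ⟨D, hD, hDle A hBA hCA, ?_⟩
    filter_upwards [hx, hy] with σ hx hy
    exact sup_le (hx.trans (σ.star_mono _ _ hBD)) (hy.trans (σ.star_mono _ _ hCD))

theorem HStar.smul_liminfStar_le (U : Filter (HStar 𝒜 K)) [U.NeBot] {x : K}
    (hx : IsHomogeneousUnit 𝒜 x) (A : HF 𝒜 K) :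
    HF.smul x hx (liminfStar U A) ≤ liminfStar U (HF.smul x hx A) := by
  intro y hy
  obtain ⟨z, hz, rfl⟩ := (HF.mem_smul hx).1 hy
  obtain ⟨B, hB, hBA, hzB⟩ := mem_liminfStar.1 hz
  refine mem_liminfStar.2 ⟨HF.smul x hx B, hB.smul hx, HF.smul_mono hx hBA, ?_⟩
  filter_upwards [hzB] with σ hσ
  rw [σ.star_smul]
  exact (HF.mem_smul hx).2 ⟨z, hσ, rfl⟩

/-- The limit inferior of the homogeneous star operations along a filter `U`: for finitely
generated `B`, an element of `K` lies in the value at `B` if and only if it lies in `B^⋆` for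
`U`-almost all `⋆`. -/
noncomputable def HStar.liminf (U : Filter (HStar 𝒜 K)) [U.NeBot] : HStar 𝒜 K where
  star := liminfStar U
  star_principal x hx := by
    refine le_antisymm (fun y hy => ?_) ?_
    · obtain ⟨B, -, hB, hy⟩ := mem_liminfStar.1 hy
      obtain ⟨σ, hσ⟩ := hy.exists
      rw [← σ.star_principal]
      exact σ.star_mono _ _ hB hσ
    · exact (le_liminfSubmodule U _).trans (coe_liminfStar U _).ge
  star_smul x hx A := by
    -- The other inclusion is the same one for `x⁻¹`, multiplied by `x`.
    refine le_antisymm ?_ (smul_liminfStar_le U hx A)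
    have h := HF.smul_mono hx (smul_liminfStar_le U hx.inv (HF.smul x hx A))
    rwa [HF.smul_inv_smul, HF.inv_smul_smul] at h
  le_star A := (le_liminfSubmodule U A).trans (coe_liminfStar U A).ge
  star_mono A B hAB x hx := by
    obtain ⟨C, hC, hCA, hx⟩ := mem_liminfStar.1 hx
    exact mem_liminfStar.2 ⟨C, hC, hCA.trans hAB, hx⟩
  star_star A := by
    refine le_antisymm (fun x hx => ?_) ((le_liminfSubmodule U _).trans (coe_liminfStar U _).ge)
    obtain ⟨B, hB, hBA, hx⟩ := mem_liminfStar.1 hx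
    obtain ⟨C, hC, hCA, hBC⟩ := exists_eventually_le_star hB
      (le_trans (b := ((liminfStar U A).1 : Submodule R K)) hBA (coe_liminfStar U A).le)
    refine mem_liminfStar.2 ⟨C, hC, hCA, ?_⟩
    -- For almost all `σ`, `x ∈ B^σ ⊆ (C^σ)^σ = C^σ`.
    filter_upwards [hx, hBC] with σ hx hBC
    have := σ.star_mono B (σ.star C) hBC
    rw [σ.star_star] at this
    exact this hx

/-- Here `B` is its own largest finitely generated subideal, so it can serve as the witness. -/
theorem HStar.mem_liminf_of_isFinGen {U : Filter (HStar 𝒜 K)} [U.NeBot] {B : HF 𝒜 K}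
    (hB : B.IsFinGen) {x : K} : x ∈ ((liminf U).star B).1 ↔ ∀ᶠ σ in U, x ∈ (σ.star B).1 := by
  refine mem_liminfStar.trans ⟨?_, fun h => ⟨B, hB, le_rfl, h⟩⟩
  rintro ⟨C, -, hCB, h⟩
  exact h.mono fun σ hσ => σ.star_mono _ _ hCB hσ

theorem HStar.isFiniteType_liminf (U : Filter (HStar 𝒜 K)) [U.NeBot] : (liminf U).IsFiniteType := by
  intro A
  ext x
  simp only [Set.mem_iUnion, exists_prop, SetLike.mem_coe]
  constructor
  · intro hx
    obtain ⟨B, hB, hBA, hx⟩ := mem_liminfStar.1 hx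
    exact ⟨B, ⟨hB, hBA⟩, (mem_liminf_of_isFinGen hB).2 hx⟩
  · rintro ⟨B, ⟨-, hBA⟩, hx⟩
    exact (liminf U).star_mono _ _ hBA hx

end HomogeneousStar

theorem mainTheorem2 {Γ : Type*} [DecidableEq Γ] [AddCancelCommMonoid Γ] [IsAddTorsionFree Γ]
    {R : Type*} [CommRing R] [IsDomain R] (𝒜 : Γ → AddSubgroup R) [GradedRing 𝒜]
    (K : Type*) [Field K] [Algebra R K] [IsFractionRing R K] :
    SpectralSpace (HomogeneousStar.HStarFin 𝒜 K) := by
  refine .of_forall_ultrafilter HomogeneousStar.HStarFin.topology_eq_generateFrom fun U => ?_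
  -- The limit is taken in `HStar(R)`, along the image of `U`, and is automatically of finite type.
  refine ⟨⟨.liminf (U.map Subtype.val : Ultrafilter _),
    HomogeneousStar.HStar.isFiniteType_liminf _⟩, ?_⟩
  rintro _ ⟨B, hB, rfl⟩
  exact HomogeneousStar.HStar.mem_liminf_of_isFinGen hB
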